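/- Let $X$ be a locally compact Hausdorff space with Borel $\sigma$-algebra $\mathcal B$, and let $C_c(X)$, resp. $C_0(X)$, be the continuous real-valued functions on $X$ that have compact support, resp. vanish at infinity. Let $E$ be a KB-space, i.e. a (real) Banach lattice in which every increasing norm bounded net in the positive cone $E^+$ is norm convergent, and let $\pi\colon C_0(X)\to E$ be a positive linear operator. Let $\overline{E}=E\cup\{\infty\}$, where $x\le\infty$ and $x+\infty=\infty+x=\infty$ for all $x\in\overline E$, $r\cdot\infty=\infty$ for real $r>0$, and $0\cdot\infty=0$; set $\overline{E^+}=E^+\cup\{\infty\}$. A *measure* $\mu\colon\mathcal B\to\overline{E^+}$ is a map with $\mu(\emptyset)=0$ and $\mu(\bigcup_{n\ge1}\Delta_n)=\bigvee_{N\ge1}\sum_{n=1}^N\mu(\Delta_n)$ in $\overline E$ for all pairwise disjoint sequences $(\Delta_n)$ in $\mathcal B$; it is *finite* if $\mu(X)\in E$. It is a *regular Borel measure* if $\mu(K)\in E$ for all compact $K$, $\mu(V)=\bigvee\{\mu(K): K\text{ compact},\ K\subseteq V\}$ in $\overline E$ for all open $V$, and $\mu(\Delta)=\bigwedge\{\mu(V):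 V\text{ open},\ \Delta\subseteq V\}$ in $\overline E$ for all $\Delta\in\mathcal B$. The *order integral* of an elementary function $\varphi=\sum_{i=1}^n r_i\mathbf 1_{\Delta_i}$ ($r_i\ge0$ real, $\Delta_i\in\mathcal B$) is $\int\varphi\,d\mu=\sum_{i=1}^n r_i\mu(\Delta_i)\in\overline{E^+}$; that of a measurable $f\colon X\to[0,\infty]$ is $\bigvee_n\int\varphi_n\,d\mu\in\overline{E^+}$ for any sequence of elementary functions $\varphi_n\uparrow f$; and for a measurable $f\colon X\to\mathbb R$ with $\int|f|\,d\mu\in E$ one sets $\int f\,d\mu=\int f^+\,d\mu-\int f^-\,d\mu\in E$. For a subset $S$ of $X$, write $f\prec S$ if $f\in C_c(X)$, $0\le f\le1$, and $\operatorname{supp} f\subseteq S$; write $S\prec f$ if $f\in C_c(X)$, $0\le f\le 1$, and $f=1$ on $S$. Then there exists a unique regular Borel measure $\mu\colon\mathcal B\to\overline{E^+}$ such that every $f\in C_c(X)$ satisfies $\int_X|f|\,d\mu\in E$ and $$\pi(f)=\int_X f\,d\mu .\qquad(*)$$ The measure $\mu$ is finite, and $\int_X|f|\,d\mu\in E$ and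 $(*)$ also hold for all $f\in C_0(X)$. If $V$ is a non-empty open subset of $X$, then $$\mu(V)=\bigvee\{\pi(f): f\prec V\}\quad\text{in } E.$$ If $K$ is a compact subset of $X$, then $$\mu(K)=\bigwedge\{\pi(f): K\prec f\}\quad\text{in } E.$$ -/

import Mathlib

open MeasureTheory Filter Topology
open scoped NNReal ENNReal ZeroAtInfty

noncomputable section

universe u

/-- A Banach lattice `E` is a KB-space if every increasing norm bounded net in its positive cone
is norm convergent. (Index sets in the universe of `E` suffice, since an increasing net converges
if and only if the net formed by its range, directed by the order of `E`, converges.) -/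
def IsKBSpace (E : Type u) [NormedAddCommGroup E] [Lattice E] : Prop :=
  ∀ (ι : Type u) [Preorder ι] [IsDirectedOrder ι] [Nonempty ι] (x : ι → E),
    Monotone x → (∀ i, 0 ≤ x i) → (∃ M : ℝ, ∀ i, ‖x i‖ ≤ M) →
      ∃ y : E, Tendsto x atTop (𝓝 y)

/-- A positive `E ∪ {∞}`-valued measure on the measurable space `X`, where `E ∪ {∞}` is
`WithTop E`: its values are positive, `∅` has measure zero, and it is `σ`-additive in the sense
of order. The value on non-measurable sets is a dummy value (as for `VectorMeasure`), so that two
such measures are equal if and only if they agree on the measurable sets. -/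
structure PosMeasure (X : Type*) [MeasurableSpace X] (E : Type*) [AddCommGroup E]
    [PartialOrder E] where
  /-- the underlying set function -/
  toFun : Set X → WithTop E
  nonneg : ∀ s, 0 ≤ toFun s
  empty : toFun ∅ = 0
  not_measurable : ∀ s, ¬ MeasurableSet s → toFun s = 0
  iUnion : ∀ s : ℕ → Set X, (∀ n, MeasurableSet (s n)) → Pairwise (Function.onFun Disjoint s) →
    IsLUB (Set.range fun N : ℕ => ∑ n ∈ Finset.range (N + 1), toFun (s n)) (toFun (⋃ n, s n))

namespace PosMeasure

instance {X : Type*} [MeasurableSpace X] {E : Type*} [AddCommGroup E] [PartialOrder E] :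
    CoeFun (PosMeasure X E) (fun _ => Set X → WithTop E) := ⟨PosMeasure.toFun⟩

section Integral

variable {X : Type*} [MeasurableSpace X] {E : Type*} [AddCommGroup E] [PartialOrder E]
  [Module ℝ E]

open Classical in
/-- The action of the nonnegative reals on `E ∪ {∞}`: `0 · ∞ = 0` and `r · ∞ = ∞` if `r > 0`. -/
def extSMul (r : ℝ≥0) : WithTop E → WithTop E
  | ⊤ => if r = 0 then 0 else ⊤
  | (x : E) => (((r : ℝ) • x : E) : WithTop E)

/-- The order integral `∑ r · μ(φ = r)` of an elementary function `φ : X → [0, ∞)`. -/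
def elemIntegral (μ : PosMeasure X E) (φ : SimpleFunc X ℝ≥0) : WithTop E :=
  ∑ r ∈ φ.range, extSMul r (μ (φ ⁻¹' {r}))

/-- `I` is the order integral of `f : X → [0, ∞]`: it is the supremum in `E ∪ {∞}` of the
integrals of the members of an increasing sequence of elementary functions that converges
pointwise to `f`. -/
def IsPosIntegral (μ : PosMeasure X E) (f : X → ℝ≥0∞) (I : WithTop E) : Prop :=
  ∃ φ : ℕ → SimpleFunc X ℝ≥0, Monotone φ ∧
    (∀ x, Tendsto (fun n => (φ n x : ℝ≥0∞)) atTop (𝓝 (f x))) ∧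
    IsLUB (Set.range fun n => μ.elemIntegral (φ n)) I

/-- The function `f : X → ℝ` is in `𝓛¹(X, μ; ℝ)`: it is measurable and the order integral of `|f|`
is finite. -/
def MemL1 (μ : PosMeasure X E) (f : X → ℝ) : Prop :=
  Measurable f ∧ ∃ c : E, μ.IsPosIntegral (fun x => ENNReal.ofReal |f x|) c

/-- The function `f : X → ℝ` is in `𝓛¹(X, μ; ℝ)`, and its order integral, which is the difference
of the order integrals of `f⁺` and `f⁻`, equals `e`. -/
def HasIntegral (μ : PosMeasure X E) (f : X → ℝ) (e : E) : Prop :=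
  μ.MemL1 f ∧ ∃ a b : E,
    μ.IsPosIntegral (fun x => ENNReal.ofReal (f x)) a ∧
    μ.IsPosIntegral (fun x => ENNReal.ofReal (-f x)) b ∧ e = a - b

end Integral

section Regularity

variable {X : Type*} [TopologicalSpace X] [MeasurableSpace X] {E : Type*} [AddCommGroup E]
  [PartialOrder E]

/-- A regular Borel measure: finite on compact sets, inner regular at all open sets, and outer
regular at all Borel sets, with suprema and infima in `E ∪ {∞}`. -/
structure IsRegularBorel (μ : PosMeasure X E) : Prop where
  finite_compact : ∀ K : Set X, IsCompact K → μ K ≠ ⊤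
  inner_open : ∀ V : Set X, IsOpen V →
    IsLUB {m | ∃ K : Set X, IsCompact K ∧ K ⊆ V ∧ μ K = m} (μ V)
  outer : ∀ s : Set X, MeasurableSet s →
    IsGLB {m | ∃ V : Set X, IsOpen V ∧ s ⊆ V ∧ μ V = m} (μ s)

end Regularity

end PosMeasure

section Precedes

variable {X : Type*} [TopologicalSpace X]

/-- `f ≺ S`: `f` is in `C_c(X)`, `0 ≤ f ≤ 1`, and the support of `f` is contained in `S`. -/
def FunPrecSet (f : C₀(X, ℝ)) (S : Set X) : Prop :=
  HasCompactSupport f ∧ (∀ x, 0 ≤ f x ∧ f x ≤ 1) ∧ tsupport f ⊆ S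

/-- `S ≺ f`: `f` is in `C_c(X)`, `0 ≤ f ≤ 1`, and `f = 1` on `S`. -/
def SetPrecFun (S : Set X) (f : C₀(X, ℝ)) : Prop :=
  HasCompactSupport f ∧ (∀ x, 0 ≤ f x ∧ f x ≤ 1) ∧ ∀ x ∈ S, f x = 1

end Precedes

end

/-! Everything is tested against the positive continuous functionals `φ` on `E`. They determine the
order, because the positive cone is closed (`le_of_forall_posDual`), and each `φ ∘ π` is represented
by a finite regular scalar measure `ρ φ`. It remains to glue the numbers `ρ φ s` into one vector `m
s` with `φ (m s) = ρ φ s` for all `φ`.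

This is where the KB property enters. Suprema of bounded directed sets are norm limits, so every `φ`
preserves them. The supremum of the `π f` with `f ≺ V` is thus a vector with the right values for
open `V`, and the infimum over open `V ⊇ s` then serves for every `s`
(`exists_forall_posDual_eq_measureReal`). Additivity, regularity and the integral formula for `m`
follow from those for all `ρ φ`.

Uniqueness has to treat measures that may take the value `∞`, so it does not scalarise the measure.
Instead, `ν K ≤ π f ≤ ν V` for `K ≺ f ≺ V` together with inner regularity shows that `π` determines
`ν` on open sets (`IsRegularBorel.isLUB_funPrecSet`). Outer regularity does the rest. -/

section BanachLattice

/-! ### Positive functionals and directed suprema in KB-spaces -/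

variable {E : Type*} [NormedAddCommGroup E] [NormedSpace ℝ E] [Lattice E]

/-- The positive continuous linear functionals on `E`. -/
abbrev PosDual (E : Type*) [NormedAddCommGroup E] [NormedSpace ℝ E] [Lattice E] : Type _ :=
  {φ : E →L[ℝ] ℝ // ∀ e, 0 ≤ e → 0 ≤ φ e}

theorem PosDual.mono [IsOrderedAddMonoid E] (φ : PosDual E) {a b : E} (h : a ≤ b) :
    φ.1 a ≤ φ.1 b := by
  have := φ.2 (b - a) (sub_nonneg.2 h)
  rw [map_sub] at this
  linarith

variable [IsOrderedAddMonoid E] [IsOrderedModule ℝ E] [HasSolidNorm E]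

/-- The positive cone is closed and convex, so Hahn–Banach separates any point outside it by a
functional that is nonnegative on the cone. -/
theorem nonneg_of_forall_posDual {a : E} (h : ∀ φ : PosDual E, 0 ≤ φ.1 a) : 0 ≤ a := by
  by_contra ha
  obtain ⟨f, hf, hfa⟩ := (ProperCone.positive ℝ E).hyperplane_separation_point (x₀ := a)
    (by simpa using ha)
  exact absurd (h ⟨f, fun e he => hf e (by simpa using he)⟩) (not_le.2 hfa)

theorem le_of_forall_posDual {a b : E} (h : ∀ φ : PosDual E, φ.1 a ≤ φ.1 b) : a ≤ b := by
  refine sub_nonneg.1 (nonneg_of_forall_posDual fun φ => ?_)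
  rw [map_sub]
  exact sub_nonneg.2 (h φ)

theorem eq_of_forall_posDual {a b : E} (h : ∀ φ : PosDual E, φ.1 a = φ.1 b) : a = b :=
  le_antisymm (le_of_forall_posDual fun φ => (h φ).le) (le_of_forall_posDual fun φ => (h φ).ge)

theorem isLUB_of_forall_posDual {D : Set E} {y : E}
    (h : ∀ φ : PosDual E, IsLUB (φ.1 '' D) (φ.1 y)) : IsLUB D y := by
  refine ⟨fun d hd => le_of_forall_posDual fun φ => (h φ).1 ⟨d, hd, rfl⟩, fun b hb =>
    le_of_forall_posDual fun φ => (h φ).2 ?_⟩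
  rintro _ ⟨d, hd, rfl⟩
  exact φ.mono (hb hd)

theorem isGLB_of_forall_posDual {D : Set E} {y : E}
    (h : ∀ φ : PosDual E, IsGLB (φ.1 '' D) (φ.1 y)) : IsGLB D y := by
  refine ⟨fun d hd => le_of_forall_posDual fun φ => (h φ).1 ⟨d, hd, rfl⟩, fun b hb =>
    le_of_forall_posDual fun φ => (h φ).2 ?_⟩
  rintro _ ⟨d, hd, rfl⟩
  exact φ.mono (hb hd)

-- `D`, indexed by itself, is an increasing net with a norm limit, and continuous positive
-- functionals carry that limit to the supremum of the image. A mere order supremum need not be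
-- preserved by every `φ`.
omit [IsOrderedModule ℝ E] [HasSolidNorm E] in
theorem IsKBSpace.exists_isLUB (hE : IsKBSpace E) {D : Set E} (hne : D.Nonempty)
    (hD : DirectedOn (· ≤ ·) D) (h0 : ∀ d ∈ D, 0 ≤ d) (hb : ∃ M : ℝ, ∀ d ∈ D, ‖d‖ ≤ M) :
    ∃ y : E, ∀ φ : PosDual E, IsLUB (φ.1 '' D) (φ.1 y) := by
  obtain ⟨M, hM⟩ := hb
  have : Nonempty D := hne.to_subtype
  have : IsDirectedOrder D := ⟨hD.directed_val⟩
  obtain ⟨y, hy⟩ := hE D (fun d => (d : E)) (fun _ _ h => h) (fun d => h0 d d.2)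
    ⟨M, fun d => hM d d.2⟩
  refine ⟨y, fun φ => ?_⟩
  have key : Tendsto (fun d : D => φ.1 d) atTop (𝓝 (φ.1 y)) := (φ.1.continuous.tendsto y).comp hy
  have := isLUB_of_tendsto_atTop (f := fun d : D => φ.1 d) (fun a b h => φ.mono h) key
  rwa [show Set.range (fun d : D => φ.1 d) = φ.1 '' D by ext; simp] at this

theorem norm_le_norm_of_nonneg_of_le {E : Type*} [NormedAddCommGroup E] [Lattice E]
    [IsOrderedAddMonoid E] [HasSolidNorm E] {a b : E} (ha : 0 ≤ a) (h : a ≤ b) : ‖a‖ ≤ ‖b‖ :=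
  norm_le_norm_of_abs_le_abs (by rwa [abs_of_nonneg ha, abs_of_nonneg (ha.trans h)])

-- Reflection at some `d₀ ∈ D`: the differences `d₀ - d` with `d ≤ d₀` are directed upwards and lie
-- in `[0, d₀]`, hence are norm bounded.
omit [IsOrderedModule ℝ E] in
theorem IsKBSpace.exists_isGLB (hE : IsKBSpace E) {D : Set E} (hne : D.Nonempty)
    (hD : DirectedOn (· ≥ ·) D) (h0 : ∀ d ∈ D, 0 ≤ d) :
    ∃ y : E, ∀ φ : PosDual E, IsGLB (φ.1 '' D) (φ.1 y) := by
  obtain ⟨d₀, hd₀⟩ := hne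
  obtain ⟨y, hy⟩ := hE.exists_isLUB (D := {e | ∃ d ∈ D, d ≤ d₀ ∧ e = d₀ - d})
    ⟨_, d₀, hd₀, le_rfl, rfl⟩
    (by
      rintro _ ⟨a, ha, ha', rfl⟩ _ ⟨b, hb, hb', rfl⟩
      obtain ⟨c, hc, hca, hcb⟩ := hD a ha b hb
      exact ⟨_, ⟨c, hc, le_trans hca ha', rfl⟩, sub_le_sub_left hca _, sub_le_sub_left hcb _⟩)
    (by rintro _ ⟨a, ha, ha', rfl⟩; exact sub_nonneg.2 ha')
    ⟨‖d₀‖, by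
      rintro _ ⟨a, ha, ha', rfl⟩
      exact norm_le_norm_of_nonneg_of_le (sub_nonneg.2 ha') (sub_le_self _ (h0 a ha))⟩
  refine ⟨d₀ - y, fun φ => ⟨?_, fun b hb => ?_⟩⟩
  · rintro _ ⟨d, hd, rfl⟩
    obtain ⟨c, hc, hcd, hc₀⟩ := hD d hd d₀ hd₀
    have h1 := (hy φ).1 ⟨_, ⟨c, hc, hc₀, rfl⟩, rfl⟩
    have h2 := φ.mono hcd
    simp only [map_sub] at h1 ⊢
    linarith
  · have : φ.1 y ≤ φ.1 d₀ - b := (hy φ).2 <| by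
      rintro _ ⟨_, ⟨c, hc, hc₀, rfl⟩, rfl⟩
      have := hb ⟨c, hc, rfl⟩
      rw [map_sub]
      linarith
    rw [map_sub]
    linarith

end BanachLattice

/-! ### Suprema and infima after adjoining `∞` -/

section WithTop

variable {E : Type*} [Preorder E] {D : Set E} {y : E}

theorem IsLUB.withTop_coe (h : IsLUB D y) : IsLUB ((fun e : E => (e : WithTop E)) '' D) y := by
  refine ⟨?_, fun b hb => ?_⟩
  · rintro _ ⟨d, hd, rfl⟩
    exact WithTop.coe_le_coe.2 (h.1 hd)
  · induction b with
    | top => exact le_top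
    | coe b => exact WithTop.coe_le_coe.2 (h.2 fun d hd => WithTop.coe_le_coe.1 (hb ⟨d, hd, rfl⟩))

theorem IsGLB.withTop_coe (h : IsGLB D y) (hD : D.Nonempty) :
    IsGLB ((fun e : E => (e : WithTop E)) '' D) y := by
  refine ⟨?_, fun b hb => ?_⟩
  · rintro _ ⟨d, hd, rfl⟩
    exact WithTop.coe_le_coe.2 (h.1 hd)
  · induction b with
    | top =>
      obtain ⟨d, hd⟩ := hD
      exact absurd (hb ⟨d, hd, rfl⟩) (WithTop.coe_lt_top d).not_ge
    | coe b => exact WithTop.coe_le_coe.2 (h.2 fun d hd => WithTop.coe_le_coe.1 (hb ⟨d, hd, rfl⟩))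

end WithTop

/-! ### Functions vanishing at infinity and scalar regular measures -/

section ZeroAtInfty

variable {X : Type*} [TopologicalSpace X]

theorem ZeroAtInftyContinuousMap.abs_apply_le_norm (f : C₀(X, ℝ)) (x : X) : |f x| ≤ ‖f‖ :=
  f.toBCF.norm_coe_le_norm x

theorem ZeroAtInftyContinuousMap.norm_le_of_forall {f : C₀(X, ℝ)} {C : ℝ} (hC : 0 ≤ C)
    (h : ∀ x, |f x| ≤ C) : ‖f‖ ≤ C :=
  (BoundedContinuousFunction.norm_le (f := f.toBCF) hC).2 h

/-- Composition with a continuous function that fixes zero. -/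
def ZeroAtInftyContinuousMap.compLeft (g : C(ℝ, ℝ)) (hg : g 0 = 0) (f : C₀(X, ℝ)) : C₀(X, ℝ) where
  toFun x := g (f x)
  continuous_toFun := g.continuous.comp f.continuous
  zero_at_infty' := by
    have := (g.continuous.tendsto 0).comp (zero_at_infty f)
    rwa [hg] at this

/-- A continuous function with compact support as a function that vanishes at infinity. -/
def ZeroAtInftyContinuousMap.ofCompact (f : C(X, ℝ)) (hf : HasCompactSupport f) : C₀(X, ℝ) :=
  ⟨f, hf.is_zero_at_infty⟩

theorem ZeroAtInftyContinuousMap.exists_hasCompactSupport_norm_sub_le [T2Space X] (f : C₀(X, ℝ)) {ε : ℝ}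
    (hε : 0 < ε) : ∃ g : C₀(X, ℝ), HasCompactSupport g ∧ ‖f - g‖ ≤ ε := by
  -- Subtracting the truncation of `f` to `[-ε, ε]` gives a function that vanishes wherever `|f| <
  -- ε`, that is, off a compact set.
  refine ⟨f.compLeft ⟨fun t => t - max (-ε) (min t ε), by fun_prop⟩ (by simp [hε.le]), ?_, ?_⟩
  · have h := (zero_at_infty f).eventually (Metric.ball_mem_nhds (0 : ℝ) hε)
    obtain ⟨K, hK, hKf⟩ := mem_cocompact.1 h
    refine HasCompactSupport.of_support_subset_isCompact hK fun x hx => ?_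
    by_contra hxK
    refine hx ?_
    have h1 : |f x| < ε := by simpa using hKf hxK
    obtain ⟨h2, h3⟩ := abs_lt.1 h1
    change f x - max (-ε) (min (f x) ε) = 0
    rw [min_eq_left h3.le, max_eq_right h2.le, sub_self]
  · refine norm_le_of_forall hε.le fun x => ?_
    change |f x - (f x - max (-ε) (min (f x) ε))| ≤ ε
    rw [sub_sub_cancel, abs_le]
    exact ⟨le_max_left _ _, max_le (by linarith) (min_le_right _ _)⟩

theorem exists_setPrecFun_funPrecSet [LocallyCompactSpace X] [T2Space X] {K V : Set X}
    (hK : IsCompact K) (hV : IsOpen V) (hKV : K ⊆ V) :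
    ∃ f : C₀(X, ℝ), SetPrecFun K f ∧ FunPrecSet f V := by
  obtain ⟨k, hk, -, hKk, hkV⟩ := exists_compact_closed_between hK hV hKV
  obtain ⟨f, hf1, hf0, hfc, hf⟩ := exists_continuous_one_zero_of_isCompact hK
    isOpen_interior.isClosed_compl (Set.disjoint_compl_right_iff_subset.2 hKk)
  refine ⟨.ofCompact f hfc, ⟨hfc, hf, hf1⟩, hfc, hf, ?_⟩
  refine (closure_minimal (fun x hx => ?_) hk.isClosed).trans hkV
  by_contra hxk
  exact hx (hf0 fun h => hxk (interior_subset h))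

/-- Positive operators are automatically bounded. If `‖π (f n)‖ > 4 ^ n`, then `g = ∑ 2⁻ⁿ f n`
converges in `C₀(X, ℝ)` and dominates each term, so `‖π g‖ ≥ 2 ^ n` for all `n`. -/
theorem exists_forall_norm_le_of_nonneg {E : Type*} [NormedAddCommGroup E] [NormedSpace ℝ E]
    [Lattice E] [IsOrderedAddMonoid E] [HasSolidNorm E] (π : C₀(X, ℝ) →ₗ[ℝ] E)
    (hπ : ∀ f : C₀(X, ℝ), (∀ x, 0 ≤ f x) → 0 ≤ π f) :
    ∃ C : ℝ, ∀ f : C₀(X, ℝ), (∀ x, 0 ≤ f x ∧ f x ≤ 1) → ‖π f‖ ≤ C := by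
  by_contra! H
  choose f hf hfn using fun n : ℕ => H (4 ^ n)
  have hnorm : ∀ n, ‖f n‖ ≤ 1 := fun n => ZeroAtInftyContinuousMap.norm_le_of_forall zero_le_one
    fun x => by rw [abs_of_nonneg (hf n x).1]; exact (hf n x).2
  have hs : Summable fun n => ((1 / 2 : ℝ) ^ n) • f n := by
    refine Summable.of_norm_bounded (summable_geometric_two) fun n => ?_
    rw [norm_smul, Real.norm_of_nonneg (by positivity)]
    exact mul_le_of_le_one_right (by positivity) (hnorm n)
  set g := ∑' n, ((1 / 2 : ℝ) ^ n) • f n with hg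
  have hle : ∀ n x, (((1 / 2 : ℝ) ^ n) • f n) x ≤ g x := by
    intro n x
    have hx : HasSum (fun n => (((1 / 2 : ℝ) ^ n) • f n) x) (g x) := by
      let ev : C₀(X, ℝ) →+ ℝ := ⟨⟨fun h => h x, rfl⟩, fun _ _ => rfl⟩
      have hev : Continuous ev := by
        refine AddMonoidHomClass.continuous_of_bound ev 1 fun h => ?_
        rw [one_mul]
        exact h.abs_apply_le_norm x
      exact hs.hasSum.map ev hev
    exact le_hasSum hx n fun k _ => mul_nonneg (by positivity) (hf k x).1
  have key : ∀ n : ℕ, (2 : ℝ) ^ n ≤ ‖π g‖ := by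
    intro n
    have h1 : 0 ≤ π (((1 / 2 : ℝ) ^ n) • f n) :=
      hπ _ fun x => mul_nonneg (by positivity) (hf n x).1
    have h2 : π (((1 / 2 : ℝ) ^ n) • f n) ≤ π g := by
      rw [← sub_nonneg, ← map_sub]
      exact hπ _ fun x => sub_nonneg.2 (hle n x)
    have h3 := norm_le_norm_of_nonneg_of_le h1 h2
    rw [map_smul, norm_smul, Real.norm_of_nonneg (by positivity)] at h3
    calc (2 : ℝ) ^ n = (1 / 2) ^ n * 4 ^ n := by rw [← mul_pow]; norm_num
      _ ≤ (1 / 2) ^ n * ‖π (f n)‖ := by gcongr; exact (hfn n).le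
      _ ≤ _ := h3
  obtain ⟨n, hn⟩ := pow_unbounded_of_one_lt ‖π g‖ (one_lt_two)
  exact absurd (key n) (not_le.2 hn)

variable [MeasurableSpace X]

theorem exists_isOpen_measureReal_lt (ρ : Measure X) [IsFiniteMeasure ρ] [ρ.Regular] (s : Set X)
    {r : ℝ} (hr : ρ.real s < r) : ∃ V, s ⊆ V ∧ IsOpen V ∧ ρ.real V < r := by
  obtain ⟨V, hsV, hV, h⟩ := s.exists_isOpen_lt_of_lt (μ := ρ) (ENNReal.ofReal r)
    ((ENNReal.lt_ofReal_iff_toReal_lt (measure_ne_top _ _)).2 hr)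
  exact ⟨V, hsV, hV, (ENNReal.lt_ofReal_iff_toReal_lt (measure_ne_top _ _)).1 h⟩

theorem isGLB_measureReal_isOpen (ρ : Measure X) [IsFiniteMeasure ρ] [ρ.Regular] (s : Set X) :
    IsGLB {r | ∃ V : Set X, IsOpen V ∧ s ⊆ V ∧ ρ.real V = r} (ρ.real s) := by
  refine ⟨?_, fun b hb => le_of_forall_gt fun r hr => ?_⟩
  · rintro _ ⟨V, -, hsV, rfl⟩
    exact measureReal_mono hsV
  · obtain ⟨V, hsV, hV, h⟩ := exists_isOpen_measureReal_lt ρ s hr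
    exact (hb ⟨V, hV, hsV, rfl⟩).trans_lt h

theorem ZeroAtInftyContinuousMap.abs_integral_le (f : C₀(X, ℝ)) (ρ : Measure X)
    [IsFiniteMeasure ρ] : |∫ x, f x ∂ρ| ≤ ‖f‖ * ρ.real Set.univ :=
  norm_integral_le_of_norm_le_const (f := f) (C := ‖f‖) (Eventually.of_forall f.abs_apply_le_norm)

variable [BorelSpace X]

theorem ZeroAtInftyContinuousMap.integrable (f : C₀(X, ℝ)) (ρ : Measure X) [IsFiniteMeasure ρ] :
    Integrable f ρ :=
  Integrable.of_bound f.continuous.measurable.aestronglyMeasurable ‖f‖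
    (Eventually.of_forall f.abs_apply_le_norm)

theorem measureReal_le_integral (ρ : Measure X) [IsFiniteMeasure ρ] {K : Set X}
    (hK : MeasurableSet K) {f : C₀(X, ℝ)} (hf : ∀ x, 0 ≤ f x) (h1 : ∀ x ∈ K, f x = 1) :
    ρ.real K ≤ ∫ x, f x ∂ρ := by
  rw [← integral_indicator_one hK]
  refine integral_mono ((integrable_const 1).indicator hK) (f.integrable ρ) fun x => ?_
  by_cases hx : x ∈ K
  · simp [hx, h1 x hx]
  · simp [hx, hf x]

theorem integral_le_measureReal (ρ : Measure X) [IsFiniteMeasure ρ] {V : Set X}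
    (hV : MeasurableSet V) {f : C₀(X, ℝ)} (hf : ∀ x, f x ≤ 1) (h1 : tsupport f ⊆ V) :
    ∫ x, f x ∂ρ ≤ ρ.real V := by
  rw [← integral_indicator_one hV]
  refine integral_mono (f.integrable ρ) ((integrable_const 1).indicator hV) fun x => ?_
  by_cases hx : x ∈ V
  · simp [hx, hf x]
  · simp [hx, image_eq_zero_of_notMem_tsupport fun h => hx (h1 h)]

variable [LocallyCompactSpace X] [T2Space X]

theorem isLUB_integral_funPrecSet (ρ : Measure X) [IsFiniteMeasure ρ] [ρ.Regular] {V : Set X}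
    (hV : IsOpen V) :
    IsLUB {r | ∃ f : C₀(X, ℝ), FunPrecSet f V ∧ ∫ x, f x ∂ρ = r} (ρ.real V) := by
  refine ⟨?_, fun b hb => ?_⟩
  · rintro _ ⟨f, hf, rfl⟩
    exact integral_le_measureReal ρ hV.measurableSet (fun x => (hf.2.1 x).2) hf.2.2
  · refine le_of_forall_lt fun r hr => ?_
    -- Negative `r` is lost in `ENNReal.ofReal`; there the function `0 ≺ V` suffices.
    rcases lt_or_ge r 0 with h0 | h0
    · refine h0.trans_le (hb ⟨0, ⟨HasCompactSupport.zero, fun x => by simp, ?_⟩, by simp⟩)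
      rw [ZeroAtInftyContinuousMap.coe_zero, tsupport_zero]
      exact Set.empty_subset _
    · obtain ⟨K, hKV, hK, hr'⟩ := hV.exists_lt_isCompact (μ := ρ) (r := ENNReal.ofReal r)
        ((ENNReal.ofReal_lt_iff_lt_toReal h0 (measure_ne_top _ _)).2 hr)
      obtain ⟨f, hKf, hfV⟩ := exists_setPrecFun_funPrecSet hK hV hKV
      calc r < ρ.real K := (ENNReal.ofReal_lt_iff_lt_toReal h0 (measure_ne_top _ _)).1 hr'
        _ ≤ ∫ x, f x ∂ρ := measureReal_le_integral ρ hK.measurableSet (fun x => (hfV.2.1 x).1) hKf.2.2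
        _ ≤ b := hb ⟨f, hfV, rfl⟩

/-- The supports of the functions `f ≺ V` already supply enough compact sets. -/
theorem isLUB_measureReal_isCompact (ρ : Measure X) [IsFiniteMeasure ρ] [ρ.Regular] {V : Set X}
    (hV : IsOpen V) :
    IsLUB {r | ∃ K : Set X, IsCompact K ∧ K ⊆ V ∧ ρ.real K = r} (ρ.real V) := by
  refine ⟨?_, fun b hb => (isLUB_integral_funPrecSet ρ hV).2 ?_⟩
  · rintro _ ⟨K, -, hKV, rfl⟩
    exact measureReal_mono hKV
  · rintro _ ⟨f, hf, rfl⟩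
    exact (integral_le_measureReal ρ (isClosed_tsupport f).measurableSet (fun x => (hf.2.1 x).2)
      subset_rfl).trans (hb ⟨_, hf.1, hf.2.2, rfl⟩)

theorem isGLB_integral_setPrecFun (ρ : Measure X) [IsFiniteMeasure ρ] [ρ.Regular] {K : Set X}
    (hK : IsCompact K) :
    IsGLB {r | ∃ f : C₀(X, ℝ), SetPrecFun K f ∧ ∫ x, f x ∂ρ = r} (ρ.real K) := by
  refine ⟨?_, fun b hb => le_of_forall_gt fun r hr => ?_⟩
  · rintro _ ⟨f, hf, rfl⟩
    exact measureReal_le_integral ρ hK.measurableSet (fun x => (hf.2.1 x).1) hf.2.2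
  · obtain ⟨V, hKV, hV, h⟩ := exists_isOpen_measureReal_lt ρ K hr
    obtain ⟨f, hKf, hfV⟩ := exists_setPrecFun_funPrecSet hK hV hKV
    exact ((hb ⟨f, hKf, rfl⟩).trans
      (integral_le_measureReal ρ hV.measurableSet (fun x => (hfV.2.1 x).2) hfV.2.2)).trans_lt h

/-- The Riesz representation theorem for positive functionals on `C₀(X, ℝ)`. -/
theorem exists_regular_measure_integral_eq (L : C₀(X, ℝ) →ₗ[ℝ] ℝ)
    (hL : ∀ f : C₀(X, ℝ), (∀ x, 0 ≤ f x) → 0 ≤ L f) :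
    ∃ ρ : Measure X, IsFiniteMeasure ρ ∧ ρ.Regular ∧ ∀ f : C₀(X, ℝ), ∫ x, f x ∂ρ = L f := by
  obtain ⟨C, hC⟩ := exists_forall_norm_le_of_nonneg L hL
  let ι : CompactlySupportedContinuousMap X ℝ →ₗ[ℝ] C₀(X, ℝ) :=
    { toFun := fun f => .ofCompact f.toContinuousMap f.hasCompactSupport
      map_add' := fun _ _ => rfl
      map_smul' := fun _ _ => rfl }
  let Λ : CompactlySupportedContinuousMap X ℝ →ₚ[ℝ] ℝ :=
    PositiveLinearMap.mk₀ (L ∘ₗ ι) fun f hf => hL _ fun x => hf x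
  have hΛ : ∀ (f : C₀(X, ℝ)) (hf : HasCompactSupport f), Λ ⟨f.toContinuousMap, hf⟩ = L f :=
    fun f hf => rfl
  set ρ := RealRMK.rieszMeasure Λ with hρ
  have hreg : ρ.Regular := RealRMK.regular_rieszMeasure Λ
  -- The mass of `X` is the supremum over compact `K`, and each `ρ K` is at most `L f ≤ C` for some
  -- `f` with `K ≺ f`.
  have hfin : IsFiniteMeasure ρ := by
    refine ⟨lt_of_le_of_lt ?_ (ENNReal.ofReal_lt_top (r := C))⟩
    rw [isOpen_univ.measure_eq_iSup_isCompact]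
    refine iSup₂_le fun K _ => iSup_le fun hK => ?_
    obtain ⟨f, hKf, -⟩ := exists_setPrecFun_funPrecSet hK isOpen_univ (Set.subset_univ K)
    refine (RealRMK.rieszMeasure_le_of_eq_one Λ (f := ⟨f.toContinuousMap, hKf.1⟩)
      (fun x => (hKf.2.1 x).1) hK hKf.2.2).trans (ENNReal.ofReal_le_ofReal ?_)
    rw [hΛ]
    exact (le_abs_self _).trans (hC f hKf.2.1)
  refine ⟨ρ, hfin, hreg, fun f => ?_⟩
  have hcc : ∀ g : C₀(X, ℝ), HasCompactSupport g → ∫ x, g x ∂ρ = L g := fun g hg =>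
    RealRMK.integral_rieszMeasure Λ ⟨g.toContinuousMap, hg⟩
  have hC0 : 0 ≤ C := (norm_nonneg _).trans (hC 0 fun x => by simp)
  -- `C` controls only functions with values in `[0, 1]`; normalising and splitting into positive
  -- and negative parts costs the factor 2. Continuity of both sides then extends the formula from
  -- `C_c(X)` to its closure.
  have hLb : ∀ h : C₀(X, ℝ), |L h| ≤ (2 * C) * ‖h‖ := by
    intro h
    rcases (norm_nonneg h).eq_or_lt with h0 | h0
    · rw [norm_eq_zero.1 h0.symm]; simp
    let p := (‖h‖⁻¹ • h).compLeft ⟨fun t => max t 0, by fun_prop⟩ (by simp)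
    let q := (‖h‖⁻¹ • h).compLeft ⟨fun t => max (-t) 0, by fun_prop⟩ (by simp)
    have hb : ∀ x, |‖h‖⁻¹ * h x| ≤ 1 := fun x => by
      rw [abs_mul, abs_inv, abs_norm, ← div_eq_inv_mul, div_le_one h0]
      exact h.abs_apply_le_norm x
    have hp := hC p fun x => ⟨le_max_right _ _, max_le (abs_le.1 (hb x)).2 zero_le_one⟩
    have hq := hC q fun x => ⟨le_max_right _ _, max_le (neg_le.1 (abs_le.1 (hb x)).1) zero_le_one⟩
    have hpq : h = ‖h‖ • (p - q) := by
      ext x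
      change h x = ‖h‖ * (max (‖h‖⁻¹ * h x) 0 - max (-(‖h‖⁻¹ * h x)) 0)
      rw [max_zero_sub_max_neg_zero_eq_self]
      field_simp
    rw [Real.norm_eq_abs] at hp hq
    calc |L h| = ‖h‖ * |L p - L q| := by
          conv_lhs => rw [hpq, map_smul, map_sub, smul_eq_mul, abs_mul, abs_norm]
      _ ≤ ‖h‖ * (|L p| + |L q|) := by gcongr; exact abs_sub _ _
      _ ≤ ‖h‖ * (C + C) := by gcongr
      _ = 2 * C * ‖h‖ := by ring
  refine eq_of_forall_dist_le fun ε hε => ?_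
  set A := ρ.real Set.univ + 2 * C + 1 with hA
  have hA0 : 0 < A := by positivity
  obtain ⟨g, hg, hfg⟩ := f.exists_hasCompactSupport_norm_sub_le (ε := ε / A) (by positivity)
  have h1 := (f - g).abs_integral_le ρ
  have h2 := hLb (f - g)
  have h3 : ∫ x, (f - g) x ∂ρ = ∫ x, f x ∂ρ - ∫ x, g x ∂ρ :=
    integral_sub (f.integrable ρ) (g.integrable ρ)
  rw [h3] at h1
  rw [map_sub] at h2
  rw [Real.dist_eq]
  calc |∫ x, f x ∂ρ - L f| = |(∫ x, f x ∂ρ - ∫ x, g x ∂ρ) - (L f - L g)| := by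
        rw [hcc g hg]; ring_nf
    _ ≤ ‖f - g‖ * ρ.real Set.univ + 2 * C * ‖f - g‖ := (abs_sub _ _).trans (add_le_add h1 h2)
    _ = ‖f - g‖ * (ρ.real Set.univ + 2 * C) := by ring
    _ ≤ (ε / A) * A := by
        gcongr
        rw [hA]; linarith
    _ = ε := by field_simp

end ZeroAtInfty

/-! ### Gluing the scalar measures into vectors -/

section Representation

variable {X : Type*} [TopologicalSpace X] [LocallyCompactSpace X] [T2Space X] [MeasurableSpace X]
  [BorelSpace X] {E : Type*} [NormedAddCommGroup E] [NormedSpace ℝ E] [Lattice E]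
  [IsOrderedAddMonoid E] [IsOrderedModule ℝ E] [HasSolidNorm E]

/-- In a KB-space, the values of the scalar Riesz measures of the positive
functionals `φ ∘ π` on a set are the images under `φ` of a single vector. -/
theorem exists_forall_posDual_eq_measureReal (hE : IsKBSpace E) (π : C₀(X, ℝ) →ₗ[ℝ] E)
    (hπ : ∀ f : C₀(X, ℝ), (∀ x, 0 ≤ f x) → 0 ≤ π f) (ρ : PosDual E → Measure X)
    [∀ φ, IsFiniteMeasure (ρ φ)] [∀ φ, (ρ φ).Regular]
    (hρ : ∀ φ f, ∫ x, f x ∂(ρ φ) = φ.1 (π f)) (s : Set X) :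
    ∃ y : E, ∀ φ : PosDual E, φ.1 y = (ρ φ).real s := by
  have hopen : ∀ V : Set X, IsOpen V → ∃ y : E, ∀ φ : PosDual E, φ.1 y = (ρ φ).real V := by
    intro V hV
    obtain ⟨C, hC⟩ := exists_forall_norm_le_of_nonneg π hπ
    obtain ⟨y, hy⟩ := hE.exists_isLUB (D := {y | ∃ f : C₀(X, ℝ), FunPrecSet f V ∧ π f = y})
      ⟨_, 0, ⟨HasCompactSupport.zero, fun x => by simp, by
        rw [ZeroAtInftyContinuousMap.coe_zero, tsupport_zero]
        exact Set.empty_subset _⟩, rfl⟩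
      (by
        rintro _ ⟨f, hf, rfl⟩ _ ⟨g, hg, rfl⟩
        have hK : IsCompact (tsupport f ∪ tsupport g) := hf.1.union hg.1
        -- Directedness: a function `h ≺ V` equal to 1 on both supports dominates `f` and `g`.
        obtain ⟨h, hKh, hhV⟩ := exists_setPrecFun_funPrecSet hK hV (Set.union_subset hf.2.2 hg.2.2)
        have key : ∀ k : C₀(X, ℝ), (∀ x, k x ≤ 1) → tsupport k ⊆ tsupport f ∪ tsupport g →
            π k ≤ π h := by
          intro k hk hks
          rw [← sub_nonneg, ← map_sub]
          refine hπ _ fun x => sub_nonneg.2 (show k x ≤ h x from ?_)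
          by_cases hx : x ∈ tsupport k
          · rw [hKh.2.2 x (hks hx)]
            exact hk x
          · rw [image_eq_zero_of_notMem_tsupport hx]
            exact (hhV.2.1 x).1
        exact ⟨_, ⟨h, hhV, rfl⟩, key f (fun x => (hf.2.1 x).2) Set.subset_union_left,
          key g (fun x => (hg.2.1 x).2) Set.subset_union_right⟩)
      (by rintro _ ⟨f, hf, rfl⟩; exact hπ f fun x => (hf.2.1 x).1)
      ⟨C, by rintro _ ⟨f, hf, rfl⟩; exact hC f hf.2.1⟩
    refine ⟨y, fun φ => (hy φ).unique ?_⟩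
    have h := isLUB_integral_funPrecSet (ρ φ) hV
    rwa [show {r | ∃ f : C₀(X, ℝ), FunPrecSet f V ∧ ∫ x, f x ∂(ρ φ) = r} =
      φ.1 '' {y | ∃ f : C₀(X, ℝ), FunPrecSet f V ∧ π f = y} by ext; simp [hρ]] at h
  choose v hv using hopen
  obtain ⟨y, hy⟩ := hE.exists_isGLB (D := {e | ∃ V, ∃ hV : IsOpen V, s ⊆ V ∧ v V hV = e})
    ⟨_, Set.univ, isOpen_univ, Set.subset_univ s, rfl⟩
    (by
      rintro _ ⟨V, hV, hsV, rfl⟩ _ ⟨W, hW, hsW, rfl⟩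
      exact ⟨_, ⟨V ∩ W, hV.inter hW, Set.subset_inter hsV hsW, rfl⟩,
        le_of_forall_posDual fun φ => by
          rw [hv, hv]; exact measureReal_mono Set.inter_subset_left,
        le_of_forall_posDual fun φ => by
          rw [hv, hv]; exact measureReal_mono Set.inter_subset_right⟩)
    (by
      rintro _ ⟨V, hV, -, rfl⟩
      exact nonneg_of_forall_posDual fun φ => by rw [hv]; exact measureReal_nonneg)
  refine ⟨y, fun φ => (hy φ).unique ?_⟩
  have h := isGLB_measureReal_isOpen (ρ φ) s
  rwa [show {r | ∃ V : Set X, IsOpen V ∧ s ⊆ V ∧ (ρ φ).real V = r} =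
    φ.1 '' {e | ∃ V, ∃ hV : IsOpen V, s ⊆ V ∧ v V hV = e} from ?_] at h
  ext r
  constructor
  · rintro ⟨V, hV, hsV, rfl⟩
    exact ⟨_, ⟨V, hV, hsV, rfl⟩, hv V hV φ⟩
  · rintro ⟨_, ⟨V, hV, hsV, rfl⟩, rfl⟩
    exact ⟨V, hV, hsV, (hv V hV φ).symm⟩

end Representation

/-! ### The glued vector measure and its integrals -/

section WeakMeasure

variable {X : Type*} [MeasurableSpace X]
  {E : Type*} [NormedAddCommGroup E] [NormedSpace ℝ E] [Lattice E]
  [IsOrderedAddMonoid E] [IsOrderedModule ℝ E] [HasSolidNorm E]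
  {m : Set X → E} {ρ : PosDual E → Measure X} [∀ φ, IsFiniteMeasure (ρ φ)]

open Classical in
/-- The positive measure whose compositions with the positive functionals are given finite
measures. -/
noncomputable def PosMeasure.ofPosDual (m : Set X → E) (ρ : PosDual E → Measure X)
    [∀ φ, IsFiniteMeasure (ρ φ)] (hm : ∀ s (φ : PosDual E), φ.1 (m s) = (ρ φ).real s) :
    PosMeasure X E where
  toFun s := if MeasurableSet s then (m s : WithTop E) else 0
  nonneg s := by
    split_ifs
    · exact WithTop.coe_le_coe.2 (nonneg_of_forall_posDual fun φ => by
        rw [hm]; exact measureReal_nonneg)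
    · exact le_rfl
  empty := by
    rw [if_pos MeasurableSet.empty]
    exact WithTop.coe_eq_coe.2 (eq_of_forall_posDual fun φ => by rw [hm]; simp)
  not_measurable s hs := if_neg hs
  iUnion s hs hd := by
    simp only [hs, if_true, MeasurableSet.iUnion hs, ← WithTop.coe_sum]
    have : IsLUB (Set.range fun N : ℕ => ∑ n ∈ Finset.range (N + 1), m (s n)) (m (⋃ n, s n)) := by
      refine isLUB_of_forall_posDual fun φ => ?_
      rw [← Set.range_comp]
      have h1 : HasSum (fun n => (ρ φ).real (s n)) ((ρ φ).real (⋃ n, s n)) := by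
        rw [Measure.real, measure_iUnion hd hs]
        rw [ENNReal.tsum_toReal_eq fun n => measure_ne_top (ρ φ) _]
        exact ENNReal.hasSum_toReal (by rw [← measure_iUnion hd hs]; exact measure_ne_top (ρ φ) _)
      have h2 : Tendsto (fun N => ∑ n ∈ Finset.range (N + 1), (ρ φ).real (s n)) atTop
          (𝓝 ((ρ φ).real (⋃ n, s n))) :=
        h1.tendsto_sum_nat.comp (tendsto_add_atTop_nat 1)
      have h3 : Monotone fun N => ∑ n ∈ Finset.range (N + 1), (ρ φ).real (s n) := fun a b hab =>
        Finset.sum_le_sum_of_subset_of_nonneg (Finset.range_mono (Nat.succ_le_succ hab))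
          fun _ _ _ => measureReal_nonneg
      have h4 : (φ.1 ∘ fun N : ℕ => ∑ n ∈ Finset.range (N + 1), m (s n)) =
          fun N => ∑ n ∈ Finset.range (N + 1), (ρ φ).real (s n) := by
        ext N
        simp [hm]
      rw [h4, hm]
      exact isLUB_of_tendsto_atTop h3 h2
    have h := this.withTop_coe
    rwa [← Set.range_comp] at h

variable {hm : ∀ s (φ : PosDual E), φ.1 (m s) = (ρ φ).real s}

theorem PosMeasure.ofPosDual_apply {s : Set X} (hs : MeasurableSet s) :
    PosMeasure.ofPosDual m ρ hm s = (m s : WithTop E) :=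
  if_pos hs

theorem PosMeasure.extSMul_coe {E : Type*} [AddCommGroup E] [PartialOrder E] [Module ℝ E] (r : ℝ≥0) (x : E) : PosMeasure.extSMul r (x : WithTop E) = ((r : ℝ) • x : E) :=
  rfl

theorem PosMeasure.elemIntegral_ofPosDual (ψ : SimpleFunc X ℝ≥0) :
    ∃ e : E, (PosMeasure.ofPosDual m ρ hm).elemIntegral ψ = e ∧
      ∀ φ, φ.1 e = (∫⁻ x, ψ x ∂(ρ φ)).toReal := by
  refine ⟨∑ r ∈ ψ.range, (r : ℝ) • m (ψ ⁻¹' {r}), ?_, fun φ => ?_⟩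
  · rw [WithTop.coe_sum]
    refine Finset.sum_congr rfl fun r _ => ?_
    rw [ofPosDual_apply (ψ.measurableSet_fiber r), extSMul_coe]
  · have h1 : ∫⁻ x, ψ x ∂(ρ φ) = ∑ r ∈ ψ.range, (r : ℝ≥0∞) * ρ φ (ψ ⁻¹' {r}) := by
      rw [← SimpleFunc.map_lintegral, ← SimpleFunc.lintegral_eq_lintegral]
      rfl
    rw [h1, ENNReal.toReal_sum fun r _ => ENNReal.mul_ne_top ENNReal.coe_ne_top
      (measure_ne_top _ _), map_sum]
    refine Finset.sum_congr rfl fun r _ => ?_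
    rw [map_smul, hm, ENNReal.toReal_mul, smul_eq_mul]
    rfl

/-- The integrals of the simple approximations increase and are dominated by a multiple of `m
Set.univ`, so the KB property gives a supremum that each `φ` respects; scalar monotone convergence
identifies its image. -/
theorem PosMeasure.exists_isPosIntegral_ofPosDual (hE : IsKBSpace E) {f : X → ℝ}
    (hf : Measurable f) (h0 : ∀ x, 0 ≤ f x) {M : ℝ} (hM : ∀ x, f x ≤ M) :
    ∃ a : E, (PosMeasure.ofPosDual m ρ hm).IsPosIntegral (fun x => ENNReal.ofReal (f x)) a ∧
      ∀ φ, φ.1 a = ∫ x, f x ∂(ρ φ) := by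
  set F : X → ℝ≥0∞ := fun x => ENNReal.ofReal (f x) with hF
  have hFm : Measurable F := hf.ennreal_ofReal
  -- `SimpleFunc.eapprox` takes only finite values, so `ENNReal.toNNReal` loses nothing.
  let ψ : ℕ → SimpleFunc X ℝ≥0 := fun n => (SimpleFunc.eapprox F n).map ENNReal.toNNReal
  have hψ : ∀ n x, (ψ n x : ℝ≥0∞) = SimpleFunc.eapprox F n x := fun n x =>
    ENNReal.coe_toNNReal (SimpleFunc.eapprox_lt_top F n x).ne
  have hψm : Monotone ψ := fun i j hij x => by
    rw [← ENNReal.coe_le_coe, hψ, hψ]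
    exact SimpleFunc.monotone_eapprox F hij x
  have hψt : ∀ x, Tendsto (fun n => (ψ n x : ℝ≥0∞)) atTop (𝓝 (F x)) := fun x => by
    simp only [hψ]
    exact SimpleFunc.tendsto_eapprox hFm x
  have hψle : ∀ n x, (ψ n x : ℝ≥0∞) ≤ F x := fun n x => by
    refine Monotone.ge_of_tendsto (fun i j hij => ?_) (hψt x) n
    exact ENNReal.coe_le_coe.2 (hψm hij x)
  have hFtop : ∀ φ, ∫⁻ x, F x ∂(ρ φ) ≤ ENNReal.ofReal M * ρ φ Set.univ := fun φ => by
    rw [← lintegral_const]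
    exact lintegral_mono fun x => ENNReal.ofReal_le_ofReal (hM x)
  have hMtop : ∀ φ, ENNReal.ofReal M * ρ φ Set.univ ≠ ⊤ := fun φ =>
    ENNReal.mul_ne_top ENNReal.ofReal_ne_top (measure_ne_top _ _)
  have hFne : ∀ φ, ∫⁻ x, F x ∂(ρ φ) ≠ ⊤ := fun φ => ne_top_of_le_ne_top (hMtop φ) (hFtop φ)
  have hψF : ∀ n φ, ∫⁻ x, ψ n x ∂(ρ φ) ≤ ∫⁻ x, F x ∂(ρ φ) := fun n φ => lintegral_mono (hψle n)
  choose e he heφ using fun n => elemIntegral_ofPosDual (hm := hm) (ψ n)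
  have hemono : Monotone e := fun i j hij => le_of_forall_posDual fun φ => by
    rw [heφ, heφ]
    exact ENNReal.toReal_mono (ne_top_of_le_ne_top (hFne φ) (hψF j φ))
      (lintegral_mono fun x => ENNReal.coe_le_coe.2 (hψm hij x))
  have he0 : ∀ n, 0 ≤ e n := fun n => nonneg_of_forall_posDual fun φ => by
    rw [heφ]; exact ENNReal.toReal_nonneg
  obtain ⟨a, ha⟩ := hE.exists_isLUB (D := Set.range e) (Set.range_nonempty e)
    hemono.directed_le.directedOn_range (by rintro _ ⟨n, rfl⟩; exact he0 n)
    ⟨‖(ENNReal.ofReal M).toReal • m Set.univ‖, by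
      rintro _ ⟨n, rfl⟩
      refine norm_le_norm_of_nonneg_of_le (he0 n) (le_of_forall_posDual fun φ => ?_)
      rw [heφ, map_smul, hm, smul_eq_mul, Measure.real, ← ENNReal.toReal_mul]
      exact ENNReal.toReal_mono (hMtop φ) ((hψF n φ).trans (hFtop φ))⟩
  refine ⟨a, ⟨ψ, hψm, hψt, ?_⟩, fun φ => ?_⟩
  · have := (isLUB_of_forall_posDual ha).withTop_coe
    rw [← Set.range_comp] at this
    simpa only [he, Function.comp_def] using this
  · refine (ha φ).unique ?_
    rw [← Set.range_comp]
    refine isLUB_of_tendsto_atTop (fun i j hij => φ.mono (hemono hij)) ?_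
    rw [integral_eq_lintegral_of_nonneg_ae (Eventually.of_forall h0) hf.aestronglyMeasurable]
    simp only [Function.comp_def, heφ]
    refine (ENNReal.tendsto_toReal (hFne φ)).comp ?_
    exact lintegral_tendsto_of_tendsto_of_monotone
      (fun n => (ψ n).measurable.coe_nnreal_ennreal.aemeasurable)
      (Eventually.of_forall fun x i j hij => ENNReal.coe_le_coe.2 (hψm hij x))
      (Eventually.of_forall hψt)

theorem PosMeasure.hasIntegral_ofPosDual (hE : IsKBSpace E) {f : X → ℝ}
    (hf : Measurable f) {M : ℝ} (hM : ∀ x, |f x| ≤ M) {y : E}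
    (hy : ∀ φ : PosDual E, φ.1 y = ∫ x, f x ∂(ρ φ)) :
    (PosMeasure.ofPosDual m ρ hm).HasIntegral f y := by
  have h0 : ∀ x, 0 ≤ M := fun x => (abs_nonneg _).trans (hM x)
  obtain ⟨c, hc, -⟩ := exists_isPosIntegral_ofPosDual (hm := hm) hE (f := fun x => |f x|) hf.abs
    (fun x => abs_nonneg _) hM
  obtain ⟨a, ha, haφ⟩ := exists_isPosIntegral_ofPosDual (hm := hm) hE (f := fun x => max (f x) 0)
    (hf.max measurable_const) (fun x => le_max_right _ _)
    (fun x => max_le ((le_abs_self _).trans (hM x)) (h0 x))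
  obtain ⟨b, hb, hbφ⟩ := exists_isPosIntegral_ofPosDual (hm := hm) hE (f := fun x => max (-f x) 0)
    (hf.neg.max measurable_const) (fun x => le_max_right _ _)
    (fun x => max_le ((neg_le_abs _).trans (hM x)) (h0 x))
  have hofReal : ∀ t : ℝ, ENNReal.ofReal (max t 0) = ENNReal.ofReal t := fun t => by
    simp [ENNReal.ofReal_max]
  simp only [hofReal] at ha hb
  refine ⟨⟨hf, c, hc⟩, a, b, ha, hb, eq_of_forall_posDual fun φ => ?_⟩
  have hi : Integrable f (ρ φ) :=
    Integrable.of_bound hf.aestronglyMeasurable M (Eventually.of_forall hM)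
  rw [hy, map_sub, haφ, hbφ]
  exact integral_eq_integral_pos_part_sub_integral_neg_part hi

end WeakMeasure

/-! ### Regularity of the glued measure -/

section WeakRegular

variable {X : Type*} [TopologicalSpace X] [LocallyCompactSpace X] [T2Space X] [MeasurableSpace X]
  [BorelSpace X] {E : Type*} [NormedAddCommGroup E] [NormedSpace ℝ E] [Lattice E]
  [IsOrderedAddMonoid E] [IsOrderedModule ℝ E] [HasSolidNorm E]
  {m : Set X → E} {ρ : PosDual E → Measure X} [∀ φ, IsFiniteMeasure (ρ φ)]
  [∀ φ, (ρ φ).Regular] {hm : ∀ s (φ : PosDual E), φ.1 (m s) = (ρ φ).real s}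

theorem PosMeasure.isRegularBorel_ofPosDual : (PosMeasure.ofPosDual m ρ hm).IsRegularBorel where
  finite_compact K hK := by
    rw [ofPosDual_apply hK.measurableSet]
    exact WithTop.coe_ne_top
  inner_open V hV := by
    rw [ofPosDual_apply hV.measurableSet]
    have : IsLUB {e | ∃ K : Set X, IsCompact K ∧ K ⊆ V ∧ m K = e} (m V) := by
      refine isLUB_of_forall_posDual fun φ => ?_
      rw [hm]
      have h := isLUB_measureReal_isCompact (ρ φ) hV
      rwa [show {r | ∃ K : Set X, IsCompact K ∧ K ⊆ V ∧ (ρ φ).real K = r} =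
        φ.1 '' {e | ∃ K : Set X, IsCompact K ∧ K ⊆ V ∧ m K = e} by ext; simp [hm, and_assoc]] at h
    have h := this.withTop_coe
    rwa [← show {e | ∃ K : Set X, IsCompact K ∧ K ⊆ V ∧ ofPosDual m ρ hm K = e} =
      (fun e : E => (e : WithTop E)) '' {e | ∃ K : Set X, IsCompact K ∧ K ⊆ V ∧ m K = e} from ?_]
      at h
    ext r
    constructor
    · rintro ⟨K, hK, hKV, rfl⟩
      exact ⟨_, ⟨K, hK, hKV, rfl⟩, (ofPosDual_apply hK.measurableSet).symm⟩
    · rintro ⟨_, ⟨K, hK, hKV, rfl⟩, rfl⟩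
      exact ⟨K, hK, hKV, ofPosDual_apply hK.measurableSet⟩
  outer s hs := by
    rw [ofPosDual_apply hs]
    have : IsGLB {e | ∃ V : Set X, IsOpen V ∧ s ⊆ V ∧ m V = e} (m s) := by
      refine isGLB_of_forall_posDual fun φ => ?_
      rw [hm]
      have h := isGLB_measureReal_isOpen (ρ φ) s
      rwa [show {r | ∃ V : Set X, IsOpen V ∧ s ⊆ V ∧ (ρ φ).real V = r} =
        φ.1 '' {e | ∃ V : Set X, IsOpen V ∧ s ⊆ V ∧ m V = e} by ext; simp [hm, and_assoc]] at h
    have h := this.withTop_coe ⟨m Set.univ, Set.univ, isOpen_univ, Set.subset_univ s, rfl⟩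
    rwa [← show {e | ∃ V : Set X, IsOpen V ∧ s ⊆ V ∧ ofPosDual m ρ hm V = e} =
      (fun e : E => (e : WithTop E)) '' {e | ∃ V : Set X, IsOpen V ∧ s ⊆ V ∧ m V = e} from ?_]
      at h
    ext r
    constructor
    · rintro ⟨V, hV, hsV, rfl⟩
      exact ⟨_, ⟨V, hV, hsV, rfl⟩, (ofPosDual_apply hV.measurableSet).symm⟩
    · rintro ⟨_, ⟨V, hV, hsV, rfl⟩, rfl⟩
      exact ⟨V, hV, hsV, ofPosDual_apply hV.measurableSet⟩

end WeakRegular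

/-! ### Additivity and integral estimates for measures that may take the value `∞` -/

namespace PosMeasure

section ExtSMul

variable {E : Type*} [AddCommGroup E] [PartialOrder E] [Module ℝ E]

theorem extSMul_zero_left (x : WithTop E) : extSMul 0 x = 0 := by
  induction x with
  | top => exact if_pos rfl
  | coe x => rw [extSMul_coe, NNReal.coe_zero, zero_smul]; rfl

theorem extSMul_top {E : Type*} [AddCommGroup E] [Module ℝ E] {r : ℝ≥0} (hr : r ≠ 0) : extSMul r (⊤ : WithTop E) = ⊤ :=
  if_neg hr

theorem extSMul_one (x : WithTop E) : extSMul 1 x = x := by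
  induction x with
  | top => exact extSMul_top one_ne_zero
  | coe x => rw [extSMul_coe, NNReal.coe_one, one_smul]

theorem extSMul_zero (r : ℝ≥0) : extSMul r (0 : WithTop E) = 0 := by
  rw [← WithTop.coe_zero, extSMul_coe, smul_zero]

theorem extSMul_add (r : ℝ≥0) (x y : WithTop E) :
    extSMul r (x + y) = extSMul r x + extSMul r y := by
  rcases eq_or_ne r 0 with rfl | hr
  · simp only [extSMul_zero_left, add_zero]
  induction x with
  | top => rw [WithTop.top_add, extSMul_top hr, WithTop.top_add]
  | coe x =>
    induction y with
    | top => rw [WithTop.add_top, extSMul_top hr, WithTop.add_top]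
    | coe y => simp only [← WithTop.coe_add, extSMul_coe, smul_add]

theorem extSMul_sum {ι : Type*} (r : ℝ≥0) (s : Finset ι) (f : ι → WithTop E) :
    extSMul r (∑ i ∈ s, f i) = ∑ i ∈ s, extSMul r (f i) :=
  map_sum (⟨⟨extSMul r, extSMul_zero r⟩, extSMul_add r⟩ : WithTop E →+ WithTop E) f s

variable [IsOrderedModule ℝ E]

theorem extSMul_nonneg (r : ℝ≥0) {x : WithTop E} (hx : 0 ≤ x) : 0 ≤ extSMul r x := by
  rcases eq_or_ne r 0 with rfl | hr
  · rw [extSMul_zero_left]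
  induction x with
  | top => rw [extSMul_top hr]; exact le_top
  | coe x => exact WithTop.coe_le_coe.2 (smul_nonneg r.2 (WithTop.coe_le_coe.1 hx))

variable [IsOrderedAddMonoid E] in
theorem extSMul_le_extSMul {r t : ℝ≥0} (h : r ≤ t) {x y : WithTop E} (hx : 0 ≤ x) (hxy : x ≤ y) :
    extSMul r x ≤ extSMul t y := by
  rcases eq_or_ne r 0 with rfl | hr
  · rw [extSMul_zero_left]
    exact extSMul_nonneg t (hx.trans hxy)
  have ht : t ≠ 0 := fun h0 => hr (le_antisymm (h0 ▸ h) zero_le)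
  induction y with
  | top => rw [extSMul_top ht]; exact le_top
  | coe y =>
    induction x with
    | top => exact absurd hxy (WithTop.coe_lt_top y).not_ge
    | coe x =>
      exact WithTop.coe_le_coe.2 (_root_.smul_le_smul (NNReal.coe_le_coe.2 h)
        (WithTop.coe_le_coe.1 hxy) r.2 (WithTop.coe_le_coe.1 (hx.trans hxy)))

end ExtSMul

section Additivity

variable {X : Type*} [MeasurableSpace X] {E : Type*} [AddCommGroup E] [PartialOrder E]
  [IsOrderedAddMonoid E] (ν : PosMeasure X E)

theorem union {A B : Set X} (hA : MeasurableSet A) (hB : MeasurableSet B) (hAB : Disjoint A B) :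
    ν (A ∪ B) = ν A + ν B := by
  let s : ℕ → Set X := fun n => match n with
    | 0 => A
    | 1 => B
    | _ + 2 => ∅
  have hsm : ∀ n, MeasurableSet (s n) := fun n => match n with
    | 0 => hA
    | 1 => hB
    | _ + 2 => MeasurableSet.empty
  have hsd : Pairwise (Function.onFun Disjoint s) := fun i j hij => match i, j with
    | 0, 0 => absurd rfl hij
    | 0, 1 => hAB
    | 1, 0 => hAB.symm
    | 1, 1 => absurd rfl hij
    | _ + 2, _ => Set.empty_disjoint _
    | 0, _ + 2 => Set.disjoint_empty _
    | 1, _ + 2 => Set.disjoint_empty _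
  have hU : ⋃ n, s n = A ∪ B := by
    ext x
    simp only [Set.mem_iUnion, Set.mem_union]
    constructor
    · rintro ⟨n, hn⟩
      match n, hn with
      | 0, hn => exact Or.inl hn
      | 1, hn => exact Or.inr hn
    · rintro (h | h)
      exacts [⟨0, h⟩, ⟨1, h⟩]
  have hsum : ∀ k, ∑ n ∈ Finset.range (k + 2), ν (s n) = ν A + ν B := fun k => by
    rw [Finset.sum_range_succ', Finset.sum_range_succ', Finset.sum_eq_zero fun i _ => ν.empty,
      zero_add, add_comm]
  have h := ν.iUnion s hsm hsd
  rw [hU] at h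
  -- After padding with `∅`, the partial sums are constant from `N = 1` on; the one at `N = 0` is
  -- only `ν A`.
  refine h.unique (IsGreatest.isLUB ⟨⟨1, hsum 0⟩, ?_⟩)
  rintro _ ⟨N, rfl⟩
  cases N with
  | zero =>
    simp only [zero_add, Finset.sum_range_one]
    exact le_add_of_nonneg_right (ν.nonneg B)
  | succ k => exact (hsum k).le

theorem mono {A B : Set X} (hA : MeasurableSet A) (hB : MeasurableSet B) (h : A ⊆ B) :
    ν A ≤ ν B := by
  rw [← Set.union_sdiff_cancel h, ν.union hA (hB.diff hA) Set.disjoint_sdiff_right]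
  exact le_add_of_nonneg_right (ν.nonneg _)

theorem biUnion_finset {ι : Type*} (S : Finset ι) {t : ι → Set X}
    (ht : ∀ i, MeasurableSet (t i)) (hd : Pairwise (Function.onFun Disjoint t)) :
    ν (⋃ i ∈ S, t i) = ∑ i ∈ S, ν (t i) := by
  classical
  induction S using Finset.induction_on with
  | empty => simpa using ν.empty
  | insert i S hi ih =>
    rw [Finset.set_biUnion_insert, ν.union (ht i) (S.measurableSet_biUnion fun j _ => ht j),
      Finset.sum_insert hi, ih]
    exact Set.disjoint_iUnion₂_right.2 fun j hj => hd fun h => hi (h ▸ hj)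

theorem eq_sum_inter_fiber {Y : Type*} (ψ : SimpleFunc X Y) {A : Set X} (hA : MeasurableSet A) :
    ν A = ∑ r ∈ ψ.range, ν (A ∩ ψ ⁻¹' {r}) := by
  rw [← ν.biUnion_finset ψ.range fun r => hA.inter (ψ.measurableSet_fiber r)]
  · congr 1
    ext x
    simp
  · exact fun r t hrt => ((Set.disjoint_singleton.2 hrt).preimage ψ).mono Set.inter_subset_right
      Set.inter_subset_right

theorem isLUB_iUnion_of_monotone {s : ℕ → Set X} (hs : ∀ n, MeasurableSet (s n))
    (hm : Monotone s) : IsLUB (Set.range fun n => ν (s n)) (ν (⋃ n, s n)) := by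
  have h := ν.iUnion (disjointed s) (fun n => MeasurableSet.disjointed hs n) (disjoint_disjointed s)
  have hsum : ∀ N : ℕ, ∑ n ∈ Finset.range (N + 1), ν (disjointed s n) = ν (s N) := fun N => by
    induction N with
    | zero => rw [zero_add, Finset.sum_range_one, disjointed_zero]
    | succ N ih =>
      rw [Finset.sum_range_succ, ih, hm.disjointed_add_one,
        ← ν.union (hs N) ((hs (N + 1)).diff (hs N)) Set.disjoint_sdiff_right,
        Set.union_sdiff_cancel (hm N.le_succ)]
  rwa [iUnion_disjointed, funext hsum] at h

end Additivity

section Integral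

variable {X : Type*} [MeasurableSpace X]

section Ordered

variable {E : Type*} [AddCommGroup E] [PartialOrder E] [Module ℝ E]
  [IsOrderedAddMonoid E] [IsOrderedModule ℝ E] (ν : PosMeasure X E)

theorem elemIntegral_nonneg (ψ : SimpleFunc X ℝ≥0) : 0 ≤ ν.elemIntegral ψ :=
  Finset.sum_nonneg fun r _ => extSMul_nonneg r (ν.nonneg _)

theorem elemIntegral_le_of_le_one (ψ : SimpleFunc X ℝ≥0) {V : Set X} (hV : MeasurableSet V)
    (h1 : ∀ x, ψ x ≤ 1) (h0 : ∀ x, x ∉ V → ψ x = 0) : ν.elemIntegral ψ ≤ ν V := by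
  rw [ν.eq_sum_inter_fiber ψ hV]
  refine Finset.sum_le_sum fun r hr => ?_
  rcases eq_or_ne r 0 with rfl | hr0
  · rw [extSMul_zero_left]
    exact ν.nonneg _
  · obtain ⟨x, rfl⟩ := SimpleFunc.mem_range.1 hr
    have : ψ ⁻¹' {ψ x} ⊆ V := fun y hy => by
      by_contra hyV
      exact hr0 ((Set.mem_singleton_iff.1 hy).symm.trans (h0 y hyV))
    rw [Set.inter_eq_self_of_subset_right this]
    exact (extSMul_le_extSMul (h1 x) (ν.nonneg _) le_rfl).trans (extSMul_one _).le

/-- A Chebyshev inequality, obtained by cutting `A` along the fibres of `ψ`. -/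
theorem extSMul_le_elemIntegral (ψ : SimpleFunc X ℝ≥0) {A : Set X} (hA : MeasurableSet A)
    {r : ℝ≥0} (h : ∀ x ∈ A, r ≤ ψ x) : extSMul r (ν A) ≤ ν.elemIntegral ψ := by
  rw [ν.eq_sum_inter_fiber ψ hA, extSMul_sum]
  refine Finset.sum_le_sum fun t _ => ?_
  rcases (A ∩ ψ ⁻¹' {t}).eq_empty_or_nonempty with he | ⟨x, hxA, hx⟩
  · rw [he, ν.empty, extSMul_zero]
    exact extSMul_nonneg _ (ν.nonneg _)
  · exact extSMul_le_extSMul ((h x hxA).trans (Set.mem_singleton_iff.1 hx).le) (ν.nonneg _)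
      (ν.mono (hA.inter (ψ.measurableSet_fiber t)) (ψ.measurableSet_fiber t)
        Set.inter_subset_right)

variable {ν} {f : X → ℝ≥0∞} {I : WithTop E}

theorem IsPosIntegral.nonneg (h : ν.IsPosIntegral f I) : 0 ≤ I := by
  obtain ⟨ψ, -, -, hI⟩ := h
  exact (ν.elemIntegral_nonneg (ψ 0)).trans (hI.1 ⟨0, rfl⟩)

theorem IsPosIntegral.le_of_le_one (h : ν.IsPosIntegral f I) {V : Set X} (hV : MeasurableSet V)
    (h1 : ∀ x, f x ≤ 1) (h0 : ∀ x, x ∉ V → f x = 0) : I ≤ ν V := by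
  obtain ⟨ψ, hψ, hψf, hI⟩ := h
  have hle : ∀ n x, (ψ n x : ℝ≥0∞) ≤ f x := fun n x =>
    Monotone.ge_of_tendsto (fun i j hij => ENNReal.coe_le_coe.2 (hψ hij x)) (hψf x) n
  refine hI.2 ?_
  rintro _ ⟨n, rfl⟩
  refine ν.elemIntegral_le_of_le_one (ψ n) hV (fun x => ?_) fun x hx => ?_
  · exact ENNReal.coe_le_one_iff.1 ((hle n x).trans (h1 x))
  · have := hle n x
    rw [h0 x hx] at this
    exact ENNReal.coe_eq_zero.1 (le_antisymm this zero_le)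

/-- The negative part vanishes identically, so its integral is at most `ν ∅ = 0`. -/
theorem HasIntegral.isPosIntegral {f : X → ℝ} {e : E} (h : ν.HasIntegral f e)
    (hf : ∀ x, 0 ≤ f x) : ν.IsPosIntegral (fun x => ENNReal.ofReal (f x)) e := by
  obtain ⟨-, a, b, ha, hb, rfl⟩ := h
  have hb0 : b = 0 := by
    refine le_antisymm (WithTop.coe_le_coe.1 ?_) (WithTop.coe_le_coe.1 hb.nonneg)
    have hz : ∀ x, ENNReal.ofReal (-f x) = 0 := fun x =>
      ENNReal.ofReal_eq_zero.2 (neg_nonpos.2 (hf x))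
    exact (hb.le_of_le_one MeasurableSet.empty (fun x => (hz x).le.trans zero_le)
      fun x _ => hz x).trans ν.empty.le
  rwa [hb0, sub_zero]

end Ordered

variable {E : Type*} [NormedAddCommGroup E] [NormedSpace ℝ E] [Lattice E]
  [IsOrderedAddMonoid E] [IsOrderedModule ℝ E] [HasSolidNorm E] {ν : PosMeasure X E}

/-- For `r < 1`, the sets `K ∩ {ψ n ≥ r}` increase to `K`, because `ψ n → f ≥ 1 > r` there.
Chebyshev on each and continuity from below give `r • ν K ≤ a`; then `r` tends to 1. -/
theorem IsPosIntegral.ge_of_one_le {f : X → ℝ≥0∞} {a : E} (h : ν.IsPosIntegral f a) {K : Set X}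
    (hK : MeasurableSet K) (hKtop : ν K ≠ ⊤) (h1 : ∀ x ∈ K, 1 ≤ f x) : ν K ≤ a := by
  obtain ⟨ψ, hψ, hψf, hI⟩ := h
  obtain ⟨k, hk⟩ := WithTop.ne_top_iff_exists.1 hKtop
  have key : ∀ r : ℝ≥0, 0 < r → r < 1 → (r : ℝ) • k ≤ a := by
    intro r hr hr1
    have hr0 : (0 : ℝ) < r := hr
    let A : ℕ → Set X := fun n => K ∩ ψ n ⁻¹' Set.Ici r
    have hAm : ∀ n, MeasurableSet (A n) := fun n => hK.inter ((ψ n).measurableSet_preimage _)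
    have hA : Monotone A := fun i j hij x hx => ⟨hx.1, le_trans hx.2 (hψ hij x)⟩
    have hAU : ⋃ n, A n = K := by
      refine Set.Subset.antisymm (Set.iUnion_subset fun n => Set.inter_subset_left) fun x hx => ?_
      have hlt : (r : ℝ≥0∞) < f x := lt_of_lt_of_le (by exact_mod_cast hr1) (h1 x hx)
      obtain ⟨n, hn⟩ := ((hψf x).eventually (lt_mem_nhds hlt)).exists
      exact Set.mem_iUnion.2 ⟨n, hx, (ENNReal.coe_lt_coe.1 hn).le⟩
    have hlub := ν.isLUB_iUnion_of_monotone hAm hA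
    rw [hAU, ← hk] at hlub
    -- With `r` moved to the right, `r⁻¹ • a` is an upper bound of the `ν (A n)` themselves, so no
    -- scalar has to pass through the supremum.
    have hub : (k : WithTop E) ≤ (((r : ℝ)⁻¹ • a : E) : WithTop E) := by
      refine hlub.2 ?_
      rintro _ ⟨n, rfl⟩
      have hle : ν (A n) ≤ k := hlub.1 ⟨n, rfl⟩
      obtain ⟨c, hc⟩ := WithTop.ne_top_iff_exists.1 (ne_top_of_le_ne_top WithTop.coe_ne_top hle)
      have h2 := (ν.extSMul_le_elemIntegral (ψ n) (hAm n) (r := r) fun x hx => hx.2).trans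
        (hI.1 ⟨n, rfl⟩)
      rw [← hc, extSMul_coe, WithTop.coe_le_coe] at h2
      simp only [← hc]
      exact WithTop.coe_le_coe.2 ((le_inv_smul_iff_of_pos hr0).2 h2)
    exact (le_inv_smul_iff_of_pos hr0).1 (WithTop.coe_le_coe.1 hub)
  rw [← hk]
  refine WithTop.coe_le_coe.2 (le_of_forall_posDual fun φ => ?_)
  have ht : Tendsto (fun r : ℝ => r * φ.1 k) (𝓝[<] 1) (𝓝 (1 * φ.1 k)) :=
    ((continuous_id.mul continuous_const).tendsto 1).mono_left nhdsWithin_le_nhds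
  rw [one_mul] at ht
  refine le_of_tendsto ht ?_
  filter_upwards [Ioo_mem_nhdsLT (zero_lt_one (α := ℝ))] with r hr
  have := φ.mono (key ⟨r, hr.1.le⟩ hr.1 hr.2)
  rwa [map_smul] at this

end Integral

/-! ### Uniqueness of the representing measure -/

section Uniqueness

variable {X : Type*} [TopologicalSpace X] [LocallyCompactSpace X] [T2Space X] [MeasurableSpace X]
  [BorelSpace X] {E : Type*} [NormedAddCommGroup E] [NormedSpace ℝ E] [Lattice E]
  [IsOrderedAddMonoid E] [IsOrderedModule ℝ E] [HasSolidNorm E] {π : C₀(X, ℝ) → E}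

/-- For compact `K ⊆ V`, some `f` with `K ≺ f ≺ V` satisfies `ν K ≤ π f ≤ ν V`, so inner regularity
makes the two suprema agree. The right side no longer involves `ν`. -/
theorem IsRegularBorel.isLUB_funPrecSet {ν : PosMeasure X E} (hν : ν.IsRegularBorel)
    (hint : ∀ f : C₀(X, ℝ), HasCompactSupport f → ν.HasIntegral f (π f)) {V : Set X}
    (hV : IsOpen V) :
    IsLUB {y : WithTop E | ∃ f : C₀(X, ℝ), FunPrecSet f V ∧ (π f : WithTop E) = y} (ν V) := by
  refine ⟨?_, fun b hb => (hν.inner_open V hV).2 ?_⟩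
  · rintro _ ⟨f, hf, rfl⟩
    refine ((hint f hf.1).isPosIntegral fun x => (hf.2.1 x).1).le_of_le_one hV.measurableSet
      (fun x => ENNReal.ofReal_le_one.2 (hf.2.1 x).2) fun x hx => ?_
    rw [image_eq_zero_of_notMem_tsupport fun h => hx (hf.2.2 h), ENNReal.ofReal_zero]
  · rintro _ ⟨K, hK, hKV, rfl⟩
    obtain ⟨f, hKf, hfV⟩ := exists_setPrecFun_funPrecSet hK hV hKV
    refine le_trans ?_ (hb ⟨f, hfV, rfl⟩)
    refine ((hint f hfV.1).isPosIntegral fun x => (hfV.2.1 x).1).ge_of_one_le hK.measurableSet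
      (hν.finite_compact K hK) fun x hx => ?_
    rw [hKf.2.2 x hx, ENNReal.ofReal_one]

theorem IsRegularBorel.eq_of_hasIntegral {μ ν : PosMeasure X E} (hμ : μ.IsRegularBorel)
    (hν : ν.IsRegularBorel)
    (hμπ : ∀ f : C₀(X, ℝ), HasCompactSupport f → μ.HasIntegral f (π f))
    (hνπ : ∀ f : C₀(X, ℝ), HasCompactSupport f → ν.HasIntegral f (π f)) : ν = μ := by
  have hopen : ∀ V : Set X, IsOpen V → ν V = μ V := fun V hV =>
    (hν.isLUB_funPrecSet hνπ hV).unique (hμ.isLUB_funPrecSet hμπ hV)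
  have heq : ν.toFun = μ.toFun := by
    funext s
    by_cases hs : MeasurableSet s
    · refine (hν.outer s hs).unique ?_
      have : {m | ∃ V : Set X, IsOpen V ∧ s ⊆ V ∧ ν V = m} =
          {m | ∃ V : Set X, IsOpen V ∧ s ⊆ V ∧ μ V = m} := by
        ext m
        exact exists_congr fun V => and_congr_right fun hV => by rw [hopen V hV]
      rw [this]
      exact hμ.outer s hs
    · rw [ν.not_measurable s hs, μ.not_measurable s hs]
  cases μ
  cases ν
  cases heq
  rfl

end Uniqueness

end PosMeasure

/-! ### The representation theorem -/

theorem mainTheorem5 {X : Type*} [TopologicalSpace X] [LocallyCompactSpace X] [T2Space X]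
    [MeasurableSpace X] [BorelSpace X]
    {E : Type*} [NormedAddCommGroup E] [NormedSpace ℝ E] [CompleteSpace E]
    [Lattice E] [IsOrderedAddMonoid E] [IsOrderedModule ℝ E] [HasSolidNorm E]
    (hE : IsKBSpace E)
    (π : C₀(X, ℝ) →ₗ[ℝ] E) (hπ : ∀ f : C₀(X, ℝ), (∀ x, 0 ≤ f x) → 0 ≤ π f) :
    ∃ μ : PosMeasure X E,
      (μ.IsRegularBorel ∧ ∀ f : C₀(X, ℝ), HasCompactSupport f → μ.HasIntegral f (π f)) ∧
      (∀ ν : PosMeasure X E, ν.IsRegularBorel →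
        (∀ f : C₀(X, ℝ), HasCompactSupport f → ν.HasIntegral f (π f)) → ν = μ) ∧
      μ Set.univ ≠ ⊤ ∧
      (∀ f : C₀(X, ℝ), μ.HasIntegral f (π f)) ∧
      (∀ V : Set X, IsOpen V → V.Nonempty →
        ∃ e : E, μ V = e ∧ IsLUB {y | ∃ f : C₀(X, ℝ), FunPrecSet f V ∧ π f = y} e) ∧
      (∀ K : Set X, IsCompact K →
        ∃ e : E, μ K = e ∧ IsGLB {y | ∃ f : C₀(X, ℝ), SetPrecFun K f ∧ π f = y} e) := by
  choose ρ hfin hreg hρ using fun φ : PosDual E =>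
    exists_regular_measure_integral_eq ((φ.1 : E →ₗ[ℝ] ℝ) ∘ₗ π) fun f hf => φ.2 _ (hπ f hf)
  -- `m` is defined on all subsets of `X`; additivity is only claimed, and inherited from `ρ φ`, on
  -- Borel sets.
  choose m hm using exists_forall_posDual_eq_measureReal hE π hπ ρ hρ
  have hint : ∀ f : C₀(X, ℝ), (PosMeasure.ofPosDual m ρ hm).HasIntegral f (π f) := fun f =>
    PosMeasure.hasIntegral_ofPosDual hE f.continuous.measurable f.abs_apply_le_norm
      fun φ => (hρ φ f).symm
  refine ⟨PosMeasure.ofPosDual m ρ hm, ⟨PosMeasure.isRegularBorel_ofPosDual, fun f _ => hint f⟩,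
    fun ν hν hνπ => PosMeasure.isRegularBorel_ofPosDual.eq_of_hasIntegral hν (fun f _ => hint f) hνπ,
    ?_, hint, fun V hV _ => ⟨m V, PosMeasure.ofPosDual_apply hV.measurableSet,
      isLUB_of_forall_posDual fun φ => ?_⟩,
    fun K hK => ⟨m K, PosMeasure.ofPosDual_apply hK.measurableSet,
      isGLB_of_forall_posDual fun φ => ?_⟩⟩
  · rw [PosMeasure.ofPosDual_apply MeasurableSet.univ]
    exact WithTop.coe_ne_top
  · have h := isLUB_integral_funPrecSet (ρ φ) hV
    rwa [show {r | ∃ f : C₀(X, ℝ), FunPrecSet f V ∧ ∫ x, f x ∂(ρ φ) = r} =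
      φ.1 '' {y | ∃ f : C₀(X, ℝ), FunPrecSet f V ∧ π f = y} by ext; simp [hρ], ← hm] at h
  · have h := isGLB_integral_setPrecFun (ρ φ) hK
    rwa [show {r | ∃ f : C₀(X, ℝ), SetPrecFun K f ∧ ∫ x, f x ∂(ρ φ) = r} =
      φ.1 '' {y | ∃ f : C₀(X, ℝ), SetPrecFun K f ∧ π f = y} by ext; simp [hρ], ← hm] at h
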